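/- Let $m\ge 0$ and $B\ge 1$ be integers, $\delta\in(0,1)$, and for $j=1,\dots,m$ let $\alpha_j\in(0,1)$, $C_{j,\max}\in\mathbb R$ and a budget $\bar\rho_j\in\mathbb R$ be given. A policy $\theta$ under rollout randomness $\xi\sim\nu$ produces a trajectory $\tau_\theta(\xi)$ with exposures $C_j(\tau_\theta(\xi))$ in the risk channels $j=1,\dots,m$. Let $\hat\theta$ be a fixed policy, chosen before the draws below, such that $\xi\mapsto C_j(\tau_{\hat\theta}(\xi))$ is measurable with values in $[0,C_{j,\max}]$ almost surely, for every $j$. Let $\xi_1,\dots,\xi_B$ be i.i.d. with law $\nu$. For a policy $\theta$ and for realised randomness $x=(x_1,\dots,x_B)$ put $$\rho_j(\theta)=\inf_{\eta\in\mathbb R}\Big(\eta+\tfrac{1}{1-\alpha_j}\,\mathbb E\big[(C_j(\tau_\theta(\xi))-\eta)_+\big]\Big),$$ $$\widehat{\mathrm{CVaR}}_{j}(\theta;x)=\inf_{\eta\in\mathbb R}\Big(\eta+\tfrac{1}{(1-\alpha_j)B}\sum_{i=1}^B (C_j(\tau_\theta(x_i))-\eta)_+\Big),$$ $$\widehat\rho_j(\theta;x)=\widehat{\mathrm{CVaR}}_{j}(\theta;x)+\frac{C_{j,\max}}{1-\alpha_j}\sqrt{\frac{\log(2m/\delta)}{2B}}.$$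 Write $\xi_{1:B}=(\xi_1,\dots,\xi_B)$. Then the following hold. 1. For each single channel $j$, with probability at least $1-\delta$, $$\rho_j(\hat\theta)\le \widehat{\mathrm{CVaR}}_{j}(\hat\theta;\xi_{1:B})+\frac{C_{j,\max}}{1-\alpha_j}\sqrt{\frac{\log(2/\delta)}{2B}}.$$ 2. With probability at least $1-\delta$, $\rho_j(\hat\theta)\le\widehat\rho_j(\hat\theta;\xi_{1:B})$ simultaneously for all $j=1,\dots,m$. 3. With probability at least $1-\delta$ the following implication holds: if $\widehat\rho_j(\hat\theta;\xi_{1:B})\le\bar\rho_j$ for all $j$, then $\rho_j(\hat\theta)\le\bar\rho_j$ for all $j$. 4. Let $\theta_k$ ($k\ge 0$) be any policies, and let $x^{(k)}$ be any realised randomness from which the estimates at step $k$ are computed. Put $g^k_j=\widehat\rho_j(\theta_k;x^{(k)})-\bar\rho_j$ and $L_k(\lambda)=\sum_{j=1}^m\lambda_j g^k_j$. Let $s>0$, $\lambda^0\in\mathbb R^m_{\ge0}$ and $\lambda^{k+1}_j=[\lambda^k_j+s\,g^k_j]_+$. Then for every $k$: $\nabla L_k(\lambda^k)=g^k$, and $\lambda^{k+1}$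 is the Euclidean projection of $\lambda^k+s\nabla L_k(\lambda^k)$ onto $\mathbb R^m_{\ge0}$; moreover $L_k(\lambda^{k+1})\ge L_k(\lambda^k)+\tfrac1s\|\lambda^{k+1}-\lambda^k\|^2$; and for each $j$, $\lambda^{k+1}_j>\lambda^k_j$ if and only if $\widehat\rho_j(\theta_k;x^{(k)})>\bar\rho_j$. -/

import Mathlib

open MeasureTheory ProbabilityTheory

noncomputable section

/-- Population Rockafellar–Uryasev objective
`φ(η) = η + (1 - α)⁻¹ 𝔼[(X - η)₊]` of a random variable `X` on `(Ξ, ν)`. -/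
def ruObjective {Ξ : Type*} [MeasurableSpace Ξ] (ν : Measure Ξ) (α : ℝ) (X : Ξ → ℝ) (η : ℝ) : ℝ :=
  η + 1 / (1 - α) * ∫ x, max (X x - η) 0 ∂ν

/-- `CVaR_α(X) = inf_η φ(η)`. -/
def cvar {Ξ : Type*} [MeasurableSpace Ξ] (ν : Measure Ξ) (α : ℝ) (X : Ξ → ℝ) : ℝ :=
  ⨅ η : ℝ, ruObjective ν α X η

/-- Empirical Rockafellar–Uryasev objective of a sample `c₁, …, c_B`. -/
def empRuObjective {B : ℕ} (α : ℝ) (c : Fin B → ℝ) (η : ℝ) : ℝ :=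
  η + 1 / ((1 - α) * B) * ∑ i, max (c i - η) 0

/-- Empirical CVaR of a sample: the infimum of the empirical Rockafellar–Uryasev objective. -/
def empCvar {B : ℕ} (α : ℝ) (c : Fin B → ℝ) : ℝ :=
  ⨅ η : ℝ, empRuObjective α c η

/-- Confidence radius `β_B(δ / m) = Cmax / (1 - α) * √(log (2 m / δ) / (2 B))` of a risk channel
with level `α` and bound `Cmax`, when `m` channels share the failure probability `δ`. -/
def cvarRadius (α Cmax : ℝ) (B m : ℕ) (δ : ℝ) : ℝ :=
  Cmax / (1 - α) * √(Real.log (2 * m / δ) / (2 * B))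

/-- Upper-confidence CVaR estimate of a sample: empirical CVaR plus confidence radius. -/
def ucbCvar {B : ℕ} (α Cmax : ℝ) (m : ℕ) (δ : ℝ) (c : Fin B → ℝ) : ℝ :=
  empCvar α c + cvarRadius α Cmax B m δ

/-- The constraint part `∑ⱼ λⱼ gⱼ` of the Lagrangian, for a vector `g` of constraint violations. -/
def lagrangianConstraint {m : ℕ} (g : EuclideanSpace ℝ (Fin m)) (lam : EuclideanSpace ℝ (Fin m)) :
    ℝ :=
  ∑ j, lam j * g j

/-- The cone of nonnegative multipliers. -/
def nonnegOrthant (m : ℕ) : Set (EuclideanSpace ℝ (Fin m)) :=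
  {lam | ∀ j, 0 ≤ lam j}

/-- `p` is the Euclidean metric projection of `v` onto `S`. -/
def IsMetricProj {m : ℕ} (S : Set (EuclideanSpace ℝ (Fin m))) (v p : EuclideanSpace ℝ (Fin m)) :
    Prop :=
  p ∈ S ∧ ∀ y ∈ S, dist v p ≤ dist v y

end

/-!
# An upper-confidence bound for the conditional value at risk

Write `p t = ν(X > t)` for the exceedance probability of an exposure `X` with values in `[0, C]`,
and `q t` for its frequency in a sample of size `B`. The excess `(X - η)₊` is the integral over
`t ∈ (0, C]` of the indicator of `η < t < X`, up to the constant `(-η)₊`, so the population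
Rockafellar–Uryasev objective exceeds the empirical one at *every* `η` by at most
`(1 - α)⁻¹ ∫₀ᶜ (p t - q t)₊ dt`. The same bound therefore holds for their infima
(`cvar_le_empCvar_add`), and no estimate that is uniform in `η` is needed.

The mean `D` of `(p t - q t)₊` over a uniform `t ∈ (0, C]` is `exceedGap`. By convexity of the
exponential function, the moment generating function of `D` is at most the largest one of
`(p t - q t)₊` for a single `t` (`mgf_integral_le`), and the latter is at most
`1 + 𝔼 exp (s (p t - q t)) ≤ 1 + exp (s² / (8 B))` by Hoeffding's lemma
(`mgf_max_exceedProb_sub_le`). Markov's inequality with `s = 4 B ε` gives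
`P(D ≥ ε) ≤ exp (-4 B ε²) + exp (-2 B ε²) ≤ 2 exp (-2 B ε²)`. These are the
constants of the Dvoretzky–Kiefer–Wolfowitz inequality in Massart's form, which is not needed here
because only an average over `t` is controlled, not a supremum. A union bound treats all channels
at once.

The update of the multipliers decouples into its coordinates, where each claim is an elementary
inequality for `max (a + s g) 0` with `a ≥ 0`.
-/

open Set

/-- The exceedance probability `ν(X > t)` of a random variable `X`. -/
noncomputable def exceedProb {Ξ : Type*} [MeasurableSpace Ξ] (ν : Measure Ξ) (X : Ξ → ℝ)
    (t : ℝ) : ℝ :=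
  ν.real {x | t < X x}

/-- The exceedance frequency of a sample: the proportion of its entries that are larger than `t`. -/
noncomputable def empExceedProb {B : ℕ} (c : Fin B → ℝ) (t : ℝ) : ℝ :=
  (∑ i, if t < c i then 1 else 0) / B

/-- By how much, on average over a uniform level `t ∈ (0, C]`, the exceedance probability of `X`
is underestimated by that of the sample `c`. -/
noncomputable def exceedGap {Ξ : Type*} [MeasurableSpace Ξ] (ν : Measure Ξ) (X : Ξ → ℝ)
    {B : ℕ} (C : ℝ) (c : Fin B → ℝ) : ℝ :=
  ∫ t, max (exceedProb ν X t - empExceedProb c t) 0 ∂(cond volume (Ioc 0 C))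

lemma integral_cond_Ioc {C : ℝ} (hC : 0 < C) (f : ℝ → ℝ) :
    ∫ t, f t ∂(cond volume (Ioc 0 C)) = C⁻¹ * ∫ t in Ioc 0 C, f t := by
  simp [ProbabilityTheory.cond, integral_smul_measure, hC.le]

lemma isProbabilityMeasure_cond_Ioc {C : ℝ} (hC : 0 < C) :
    IsProbabilityMeasure (cond (volume : Measure ℝ) (Ioc 0 C)) :=
  cond_isProbabilityMeasure_of_finite (by simp [hC]) (by simp)

/-! ### Exceedance probabilities and the pathwise comparison of CVaRs -/

section Exceedance

variable {Ξ : Type*} [MeasurableSpace Ξ] {ν : Measure Ξ} {X : Ξ → ℝ}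

lemma measurable_exceedProb [IsFiniteMeasure ν] : Measurable (exceedProb ν X) := by
  refine Antitone.measurable fun s t hst => ?_
  exact measureReal_mono (fun x (hx : t < X x) => hst.trans_lt hx)

lemma exceedProb_nonneg (t : ℝ) : 0 ≤ exceedProb ν X t := measureReal_nonneg

lemma exceedProb_le_one [IsProbabilityMeasure ν] (t : ℝ) : exceedProb ν X t ≤ 1 :=
  measureReal_le_one

lemma measurable_empExceedProb {B : ℕ} (c : Fin B → ℝ) : Measurable (empExceedProb c) := by
  unfold empExceedProb
  refine (Finset.measurable_sum _ fun i _ => ?_).div_const _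
  exact Measurable.ite measurableSet_Iio measurable_const measurable_const

lemma empExceedProb_nonneg {B : ℕ} (c : Fin B → ℝ) (t : ℝ) : 0 ≤ empExceedProb c t := by
  unfold empExceedProb
  exact div_nonneg (Finset.sum_nonneg fun i _ => by split_ifs <;> norm_num) (by positivity)

lemma empExceedProb_le_one {B : ℕ} (c : Fin B → ℝ) (t : ℝ) : empExceedProb c t ≤ 1 := by
  unfold empExceedProb
  refine div_le_one_of_le₀ ?_ (by positivity)
  calc (∑ i, if t < c i then (1 : ℝ) else 0) ≤ ∑ _i : Fin B, (1 : ℝ) :=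
        Finset.sum_le_sum fun i _ => by split_ifs <;> norm_num
    _ = B := by simp

/-- The layer-cake formula for the excess over `η`. For `η < 0` the layers below level `0`, which
lie outside `(0, C]`, contribute the constant `-η`. -/
lemma max_sub_zero_eq_add_setIntegral {C c : ℝ} (hc : c ∈ Icc 0 C) (η : ℝ) :
    max (c - η) 0 = max (-η) 0 + ∫ t in Ioc 0 C, (Ioo η c).indicator (fun _ => (1 : ℝ)) t := by
  rw [setIntegral_indicator measurableSet_Ioo, setIntegral_const]
  have : (Ioc 0 C ∩ Ioo η c : Set ℝ) =ᵐ[volume] (Ioc (max η 0) c : Set ℝ) := by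
    have h : Ioc 0 C ∩ Ioo η c = Ioo (max η 0) c := by
      ext t
      simp only [mem_inter_iff, mem_Ioc, mem_Ioo, max_lt_iff]
      constructor
      · rintro ⟨⟨h1, h2⟩, h3, h4⟩; exact ⟨⟨h3, h1⟩, h4⟩
      · rintro ⟨⟨h1, h2⟩, h3⟩; exact ⟨⟨h2, h3.le.trans hc.2⟩, h1, h3⟩
    rw [h]; exact Ioo_ae_eq_Ioc
  rw [measureReal_congr this]
  have h0 := hc.1
  simp only [Real.volume_real_Ioc, smul_eq_mul, mul_one]
  grind

lemma integral_max_sub_zero [IsProbabilityMeasure ν] (hX : Measurable X) {C : ℝ}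
    (hb : ∀ᵐ x ∂ν, X x ∈ Icc 0 C) (η : ℝ) :
    ∫ x, max (X x - η) 0 ∂ν =
      max (-η) 0 + ∫ t in Ioc 0 C, (Ioi η).indicator (exceedProb ν X) t := by
  have hmeas : MeasurableSet {p : Ξ × ℝ | η < p.2 ∧ p.2 < X p.1} :=
    (measurableSet_lt measurable_const measurable_snd).inter
      (measurableSet_lt measurable_snd (hX.comp measurable_fst))
  have hint : Integrable (Function.uncurry fun (x : Ξ) (t : ℝ) =>
      (Ioo η (X x)).indicator (fun _ => (1 : ℝ)) t) (ν.prod (volume.restrict (Ioc 0 C))) := by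
    exact (integrable_const (1 : ℝ)).indicator hmeas
  rw [integral_congr_ae (hb.mono fun x hx => max_sub_zero_eq_add_setIntegral hx η),
    integral_add (integrable_const _) (by exact hint.integral_prod_left),
    integral_integral_swap hint]
  simp only [integral_const, probReal_univ, one_smul]
  congr 1
  refine integral_congr_ae (ae_of_all _ fun t => ?_)
  by_cases ht : η < t
  · have : ∀ x, (Ioo η (X x)).indicator (fun _ => (1 : ℝ)) t
        = {x | t < X x}.indicator (fun _ => (1 : ℝ)) x := by
      intro x; simp [indicator_apply, ht]
    simp only [this]
    rw [integral_indicator_const _ (measurableSet_lt measurable_const hX)]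
    simp [ht, exceedProb]
  · simp [ht]

lemma mean_max_sub_zero {B : ℕ} (hB : 0 < B) {c : Fin B → ℝ} {C : ℝ}
    (hc : ∀ i, c i ∈ Icc 0 C) (η : ℝ) :
    (∑ i, max (c i - η) 0) / B =
      max (-η) 0 + ∫ t in Ioc 0 C, (Ioi η).indicator (empExceedProb c) t := by
  have hB' : (B : ℝ) ≠ 0 := by positivity
  have hint : ∀ i, Integrable ((Ioo η (c i)).indicator fun _ => (1 : ℝ))
      (volume.restrict (Ioc 0 C)) :=
    fun i => (integrable_const (1 : ℝ)).indicator measurableSet_Ioo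
  rw [Finset.sum_congr rfl fun i _ => max_sub_zero_eq_add_setIntegral (hc i) η,
    Finset.sum_add_distrib, ← integral_finsetSum _ fun i _ => hint i, add_div, ← integral_div]
  simp only [Finset.sum_const, Finset.card_univ, Fintype.card_fin, nsmul_eq_mul]
  rw [mul_div_cancel_left₀ _ hB']
  congr 2
  ext t
  by_cases ht : η < t <;> simp [indicator_apply, ht, empExceedProb]

lemma integrable_exceedProb_sub [IsProbabilityMeasure ν] {κ : Measure ℝ} [IsFiniteMeasure κ]
    {B : ℕ} (c : Fin B → ℝ) :
    Integrable (fun t => max (exceedProb ν X t - empExceedProb c t) 0) κ := by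
  refine Integrable.of_mem_Icc 0 1 ?_
    (ae_of_all _ fun t => ⟨le_max_right _ _, max_le ?_ zero_le_one⟩)
  · exact ((measurable_exceedProb.sub (measurable_empExceedProb c)).max
      measurable_const).aemeasurable
  · linarith [exceedProb_le_one (ν := ν) (X := X) t, empExceedProb_nonneg c t]

lemma integral_max_sub_zero_le [IsProbabilityMeasure ν] (hX : Measurable X) {C : ℝ}
    (hb : ∀ᵐ x ∂ν, X x ∈ Icc 0 C) {B : ℕ} (hB : 0 < B) {c : Fin B → ℝ}
    (hc : ∀ i, c i ∈ Icc 0 C) (η : ℝ) :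
    ∫ x, max (X x - η) 0 ∂ν ≤ (∑ i, max (c i - η) 0) / B +
      ∫ t in Ioc 0 C, max (exceedProb ν X t - empExceedProb c t) 0 := by
  rw [integral_max_sub_zero hX hb, mean_max_sub_zero hB hc, add_assoc, ← integral_add]
  · gcongr 1
    refine integral_mono ?_ ?_ fun t => ?_
    · refine Integrable.indicator ?_ measurableSet_Ioi
      exact Integrable.of_mem_Icc 0 1 measurable_exceedProb.aemeasurable
        (ae_of_all _ fun t => ⟨exceedProb_nonneg t, exceedProb_le_one t⟩)
    · refine Integrable.add (Integrable.indicator ?_ measurableSet_Ioi)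
        (integrable_exceedProb_sub c)
      exact Integrable.of_mem_Icc 0 1 (measurable_empExceedProb c).aemeasurable
        (ae_of_all _ fun t => ⟨empExceedProb_nonneg c t, empExceedProb_le_one c t⟩)
    · simp only [indicator_apply]
      split_ifs <;> grind
  · refine Integrable.indicator ?_ measurableSet_Ioi
    exact Integrable.of_mem_Icc 0 1 (measurable_empExceedProb c).aemeasurable
        (ae_of_all _ fun t => ⟨empExceedProb_nonneg c t, empExceedProb_le_one c t⟩)
  · exact integrable_exceedProb_sub c

lemma ruObjective_nonneg [IsProbabilityMeasure ν] (hX : Measurable X) {C : ℝ}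
    (hb : ∀ᵐ x ∂ν, X x ∈ Icc 0 C) {α : ℝ} (hα0 : 0 < α) (hα1 : α < 1) (η : ℝ) :
    0 ≤ ruObjective ν α X η := by
  unfold ruObjective
  rw [integral_max_sub_zero hX hb]
  have h1 : 0 ≤ ∫ t in Ioc 0 C, (Ioi η).indicator (exceedProb ν X) t :=
    integral_nonneg fun t => indicator_nonneg (fun t _ => exceedProb_nonneg t) t
  have h2 : 1 ≤ 1 / (1 - α) := by
    rw [le_div_iff₀ (by linarith)]; linarith
  have h3 := le_max_left (-η) 0
  have h4 := le_max_right (-η) 0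
  nlinarith

/-- The pathwise comparison of population and empirical CVaR. At every `η` the population objective
exceeds the empirical one by at most the same quantity, a multiple of the exceedance gap. -/
lemma cvar_le_empCvar_add [IsProbabilityMeasure ν] (hX : Measurable X) {C : ℝ}
    (hb : ∀ᵐ x ∂ν, X x ∈ Icc 0 C) {α : ℝ} (hα0 : 0 < α) (hα1 : α < 1) {B : ℕ} (hB : 0 < B)
    {c : Fin B → ℝ} (hc : ∀ i, c i ∈ Icc 0 C) :
    cvar ν α X ≤ empCvar α c + C / (1 - α) * exceedGap ν X C c := by
  have hC : 0 ≤ C := (hc ⟨0, hB⟩).1.trans (hc ⟨0, hB⟩).2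
  have hgap : C * exceedGap ν X C c =
      ∫ t in Ioc 0 C, max (exceedProb ν X t - empExceedProb c t) 0 := by
    rcases hC.eq_or_lt with rfl | hC
    · simp
    · rw [exceedGap, integral_cond_Ioc hC, mul_inv_cancel_left₀ hC.ne']
  rw [← sub_le_iff_le_add]
  refine le_ciInf fun η => ?_
  rw [sub_le_iff_le_add]
  refine (ciInf_le ⟨0, ?_⟩ η).trans ?_
  · rintro _ ⟨η, rfl⟩; exact ruObjective_nonneg hX hb hα0 hα1 η
  · have h := mul_le_mul_of_nonneg_left (integral_max_sub_zero_le hX hb hB hc η)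
      (show 0 ≤ 1 / (1 - α) by apply div_nonneg <;> linarith)
    rw [← hgap] at h
    have hα : 1 - α ≠ 0 := by linarith
    have hB' : (B : ℝ) ≠ 0 := by positivity
    unfold ruObjective empRuObjective
    calc _ ≤ η + 1 / (1 - α) * ((∑ i, max (c i - η) 0) / B + C * exceedGap ν X C c) := by
          linarith
      _ = _ := by field_simp; ring

end Exceedance

/-! ### Concentration of the exceedance gap -/

/-- Jensen's inequality for the exponential function: a bound on the moment generating functions of
all members of a bounded family passes to the mean of the family. -/
lemma mgf_integral_le {Ω T : Type*} [MeasurableSpace Ω] [MeasurableSpace T] {P : Measure Ω}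
    {κ : Measure T} [IsProbabilityMeasure P] [IsProbabilityMeasure κ] {W : Ω → T → ℝ}
    (hW : AEMeasurable (Function.uncurry W) (P.prod κ)) (hb : ∀ ω t, W ω t ∈ Icc 0 1)
    {s M : ℝ} (hM : ∀ t, mgf (fun ω => W ω t) P s ≤ M) :
    mgf (fun ω => ∫ t, W ω t ∂κ) P s ≤ M := by
  have hWint : Integrable (Function.uncurry W) (P.prod κ) :=
    Integrable.of_mem_Icc 0 1 hW (ae_of_all _ fun p => hb p.1 p.2)
  have hexp : Integrable (Function.uncurry fun ω t => Real.exp (s * W ω t)) (P.prod κ) :=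
    integrable_exp_mul_of_mem_Icc hW (ae_of_all _ fun p => hb p.1 p.2)
  have hmean : Integrable (fun ω => Real.exp (s * ∫ t, W ω t ∂κ)) P := by
    refine integrable_exp_mul_of_mem_Icc (a := 0) (b := 1) hWint.integral_prod_left.aemeasurable
      (ae_of_all _ fun ω => ⟨integral_nonneg fun t => (hb ω t).1, ?_⟩)
    refine (integral_mono_of_nonneg (ae_of_all _ fun t => (hb ω t).1) (integrable_const 1)
      (ae_of_all _ fun t => (hb ω t).2)).trans ?_
    simp
  calc mgf (fun ω => ∫ t, W ω t ∂κ) P s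
      ≤ ∫ ω, ∫ t, Real.exp (s * W ω t) ∂κ ∂P := by
        refine integral_mono_ae hmean hexp.integral_prod_left ?_
        filter_upwards [hWint.prod_right_ae, hexp.prod_right_ae] with ω h1 h2
        have := convexOn_exp.map_integral_le Real.continuous_exp.continuousOn isClosed_univ
          (ae_of_all κ fun t => mem_univ (s * W ω t)) (h1.const_mul s) h2
        rwa [integral_const_mul] at this
    _ = ∫ t, mgf (fun ω => W ω t) P s ∂κ := integral_integral_swap hexp
    _ ≤ ∫ _, M ∂κ := integral_mono hexp.integral_prod_right (integrable_const M) hM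
    _ = M := by simp

section Concentration

variable {Ξ Ω : Type*} [MeasurableSpace Ξ] [MeasurableSpace Ω] {ν : Measure Ξ}
  {P : Measure Ω} {B : ℕ} {ξ : Fin B → Ω → Ξ}
  {X : Ξ → ℝ}

lemma aemeasurable_uncurry_max_exceedProb_sub [IsFiniteMeasure ν]
    (hlaw : ∀ i, HasLaw (ξ i) ν P) (hX : Measurable X) (κ : Measure ℝ) [SFinite κ] :
    AEMeasurable (Function.uncurry fun ω t =>
      max (exceedProb ν X t - empExceedProb (fun i => X (ξ i ω)) t) 0) (P.prod κ) := by
  refine AEMeasurable.max (AEMeasurable.sub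
    (measurable_exceedProb.comp measurable_snd).aemeasurable ?_) aemeasurable_const
  refine (Finset.aemeasurable_fun_sum _ fun i _ => ?_).div_const _
  have h1 : AEMeasurable (fun p : Ω × ℝ => (X (ξ i p.1), p.2)) (P.prod κ) :=
    ((hX.comp_aemeasurable (hlaw i).aemeasurable).comp_quasiMeasurePreserving
      Measure.quasiMeasurePreserving_fst).prodMk measurable_snd.aemeasurable
  have h2 : Measurable fun q : ℝ × ℝ => if q.2 < q.1 then (1 : ℝ) else 0 :=
    Measurable.ite (measurableSet_lt measurable_snd measurable_fst) measurable_const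
      measurable_const
  exact h2.comp_aemeasurable h1

variable [IsProbabilityMeasure P]

/-- Hoeffding's lemma for the frequency of the event `X > t`. -/
lemma integrable_exp_and_mgf_exceedProb_sub_le (hB : 0 < B) (hlaw : ∀ i, HasLaw (ξ i) ν P)
    (hindep : iIndepFun ξ P) (hX : Measurable X) (t : ℝ) (s : ℝ) :
    Integrable (fun ω => Real.exp (s * (exceedProb ν X t - empExceedProb (fun i => X (ξ i ω)) t))) P
      ∧ mgf (fun ω => exceedProb ν X t - empExceedProb (fun i => X (ξ i ω)) t) P s
        ≤ Real.exp (s ^ 2 / (8 * B)) := by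
  have hB' : (B : ℝ) ≠ 0 := by positivity
  set f : Ξ → ℝ := fun x => if t < X x then 1 else 0 with hf
  have hfm : Measurable f :=
    Measurable.ite (measurableSet_lt measurable_const hX) measurable_const measurable_const
  have hfb : ∀ x, f x ∈ Icc (0 : ℝ) 1 := fun x => by simp only [hf]; split_ifs <;> simp
  have hmean : ∀ i, ∫ ω, f (ξ i ω) ∂P = exceedProb ν X t := fun i => by
    have h1 : f = {x | t < X x}.indicator (fun _ => (1 : ℝ)) := by
      ext x; simp [hf, indicator_apply]
    have h2 := (hlaw i).integral_comp hfm.aestronglyMeasurable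
    simp only [Function.comp_def] at h2
    rw [h2, h1, integral_indicator_const _ (measurableSet_lt measurable_const hX)]
    simp [exceedProb]
  have hsub : ∀ i, HasSubgaussianMGF (fun ω => f (ξ i ω) - exceedProb ν X t)
      ((‖(1 : ℝ) - 0‖₊ / 2) ^ 2) P := fun i => by
    rw [← hmean i]
    exact hasSubgaussianMGF_of_mem_Icc (hfm.comp_aemeasurable (hlaw i).aemeasurable)
      (ae_of_all _ fun ω => hfb _)
  have hind : iIndepFun (fun i ω => f (ξ i ω) - exceedProb ν X t) P :=
    hindep.comp (fun _ x => f x - exceedProb ν X t) fun _ => hfm.sub_const _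
  have hsum := HasSubgaussianMGF.sum_of_iIndepFun hind (s := Finset.univ) fun i _ => hsub i
  have heq : ∀ ω, s * (exceedProb ν X t - empExceedProb (fun i => X (ξ i ω)) t) =
      (-s / B) * ∑ i, (f (ξ i ω) - exceedProb ν X t) := fun ω => by
    simp only [empExceedProb, Finset.sum_sub_distrib, Finset.sum_const, Finset.card_univ,
      Fintype.card_fin, nsmul_eq_mul, hf]
    field_simp
    ring
  simp only [mgf, heq]
  refine ⟨hsum.integrable_exp_mul _, (hsum.mgf_le (-s / B)).trans_eq ?_⟩
  congr 1
  simp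
  field_simp
  ring

/-- Passing to the positive part costs only an additive `1`, because `exp (max a 0) ≤ 1 + exp a`. -/
lemma mgf_max_exceedProb_sub_le (hB : 0 < B) (hlaw : ∀ i, HasLaw (ξ i) ν P)
    (hindep : iIndepFun ξ P) (hX : Measurable X) (t : ℝ) {s : ℝ} :
    mgf (fun ω => max (exceedProb ν X t - empExceedProb (fun i => X (ξ i ω)) t) 0) P s
      ≤ 1 + Real.exp (s ^ 2 / (8 * B)) := by
  obtain ⟨hint, hle⟩ := integrable_exp_and_mgf_exceedProb_sub_le hB hlaw hindep hX t s
  calc _ ≤ ∫ ω, (1 +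
        Real.exp (s * (exceedProb ν X t - empExceedProb (fun i => X (ξ i ω)) t))) ∂P := by
        refine integral_mono_of_nonneg (ae_of_all _ fun ω => (Real.exp_pos _).le)
          ((integrable_const 1).add hint) (ae_of_all _ fun ω => ?_)
        dsimp only
        rcases max_cases (exceedProb ν X t - empExceedProb (fun i => X (ξ i ω)) t) 0 with h | h <;>
          rw [h.1]
        · linarith
        · simp [Real.exp_nonneg]
    _ ≤ _ := by
        rw [integral_add (integrable_const 1) hint]
        simpa [mgf] using hle

variable [IsProbabilityMeasure ν]

lemma measureReal_exceedGap_ge_le (hB : 0 < B) (hlaw : ∀ i, HasLaw (ξ i) ν P)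
    (hindep : iIndepFun ξ P) (hX : Measurable X) {C : ℝ} (hC : 0 < C) {ε : ℝ} (hε : 0 ≤ ε) :
    P.real {ω | ε ≤ exceedGap ν X C (fun i => X (ξ i ω))} ≤ 2 * Real.exp (-(2 * B * ε ^ 2)) := by
  have := isProbabilityMeasure_cond_Ioc hC
  have hW := aemeasurable_uncurry_max_exceedProb_sub (X := X) hlaw hX (cond volume (Ioc 0 C))
  have hWb : ∀ (ω : Ω) (t : ℝ),
      max (exceedProb ν X t - empExceedProb (fun i => X (ξ i ω)) t) 0 ∈ Icc (0 : ℝ) 1 :=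
    fun ω t => ⟨le_max_right _ _, max_le (by
      linarith [exceedProb_le_one (ν := ν) (X := X) t,
        empExceedProb_nonneg (fun i => X (ξ i ω)) t]) zero_le_one⟩
  have hgap : Integrable (fun ω => exceedGap ν X C (fun i => X (ξ i ω))) P :=
    (Integrable.of_mem_Icc 0 1 hW (ae_of_all _ fun p => hWb p.1 p.2)).integral_prod_left
  have hgapb : ∀ ω, exceedGap ν X C (fun i => X (ξ i ω)) ∈ Icc (0 : ℝ) 1 := fun ω => by
    refine ⟨integral_nonneg fun t => (hWb ω t).1, ?_⟩
    refine (integral_mono_of_nonneg (ae_of_all _ fun t => (hWb ω t).1) (integrable_const 1)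
      (ae_of_all _ fun t => (hWb ω t).2)).trans ?_
    simp
  -- `s = 4 B ε` minimises `exp (-s ε + s ^ 2 / (8 B))`
  have hmgf : mgf (fun ω => exceedGap ν X C (fun i => X (ξ i ω))) P (4 * B * ε) ≤
      1 + Real.exp ((4 * B * ε) ^ 2 / (8 * B)) :=
    mgf_integral_le hW hWb fun t => mgf_max_exceedProb_sub_le hB hlaw hindep hX t
  have hB' : (B : ℝ) ≠ 0 := by positivity
  calc _ ≤ Real.exp (-(4 * B * ε) * ε) *
        mgf (fun ω => exceedGap ν X C (fun i => X (ξ i ω))) P (4 * B * ε) :=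
        measure_ge_le_exp_mul_mgf ε (by positivity)
          (integrable_exp_mul_of_mem_Icc hgap.aemeasurable (ae_of_all _ hgapb))
    _ ≤ Real.exp (-(4 * B * ε) * ε) * (1 + Real.exp ((4 * B * ε) ^ 2 / (8 * B))) := by gcongr
    _ = Real.exp (-(4 * B * ε ^ 2)) + Real.exp (-(2 * B * ε ^ 2)) := by
        rw [mul_add, ← Real.exp_add, mul_one]
        congr 2
        · ring
        · field_simp
          ring
    _ ≤ 2 * Real.exp (-(2 * B * ε ^ 2)) := by
        have : Real.exp (-(4 * B * ε ^ 2)) ≤ Real.exp (-(2 * B * ε ^ 2)) := by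
          apply Real.exp_le_exp.2
          have : 0 ≤ (B : ℝ) * ε ^ 2 := by positivity
          linarith
        linarith

/-- The event need not be measurable, since `empCvar` is an infimum over uncountably many `η`; it is
covered, up to a null set, by the event that the exceedance gap is at least `ε`. -/
lemma measureReal_not_cvar_le_le (hB : 0 < B) (hlaw : ∀ i, HasLaw (ξ i) ν P)
    (hindep : iIndepFun ξ P) (hX : Measurable X) {C : ℝ} (hb : ∀ᵐ x ∂ν, X x ∈ Icc 0 C)
    {α : ℝ} (hα0 : 0 < α) (hα1 : α < 1) {ε : ℝ} (hε : 0 ≤ ε) :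
    P.real {ω | ¬ cvar ν α X ≤ empCvar α (fun i => X (ξ i ω)) + C / (1 - α) * ε} ≤
      2 * Real.exp (-(2 * B * ε ^ 2)) := by
  have hbP : ∀ᵐ ω ∂P, ∀ i, X (ξ i ω) ∈ Icc 0 C := ae_all_iff.2 fun i =>
    ((hlaw i).ae_iff (measurableSet_Icc.preimage hX).mem).2 hb
  have hcv : ∀ᵐ ω ∂P, cvar ν α X ≤ empCvar α (fun i => X (ξ i ω)) +
      C / (1 - α) * exceedGap ν X C (fun i => X (ξ i ω)) :=
    hbP.mono fun ω h => cvar_le_empCvar_add hX hb hα0 hα1 hB h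
  obtain ⟨x, hx⟩ := hb.exists
  rcases (hx.1.trans hx.2).eq_or_lt with rfl | hC
  -- for `C = 0` the uniform law on `(0, C]` degenerates, but the gap enters with the factor `0`
  · have : P.real {ω | ¬ cvar ν α X ≤ empCvar α (fun i => X (ξ i ω)) + 0 / (1 - α) * ε} = 0 := by
      simp only [zero_div, zero_mul] at hcv ⊢
      rw [measureReal_def, ae_iff.1 hcv, ENNReal.toReal_zero]
    rw [this]; positivity
  · refine le_trans ?_ (measureReal_exceedGap_ge_le hB hlaw hindep hX hC hε)
    refine ENNReal.toReal_mono (measure_ne_top _ _) (measure_mono_ae ?_)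
    filter_upwards [hcv] with ω h1 (h2 : ¬ _)
    by_contra h3
    refine h2 (h1.trans ?_)
    have h3 : exceedGap ν X C (fun i => X (ξ i ω)) ≤ ε := (not_le.1 h3).le
    have : 0 ≤ C / (1 - α) := div_nonneg hC.le (by linarith)
    gcongr

/-- The radius with `K` in place of the number of channels has failure probability at most
`δ / K`. -/
lemma measureReal_not_cvar_le_le_div (hB : 0 < B) (hlaw : ∀ i, HasLaw (ξ i) ν P)
    (hindep : iIndepFun ξ P) (hX : Measurable X) {C : ℝ} (hb : ∀ᵐ x ∂ν, X x ∈ Icc 0 C)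
    {α : ℝ} (hα0 : 0 < α) (hα1 : α < 1) {δ K : ℝ} (hδ0 : 0 < δ) (hδ1 : δ < 1) (hK : 1 ≤ K) :
    P.real {ω | ¬ cvar ν α X ≤ empCvar α (fun i => X (ξ i ω)) +
      C / (1 - α) * √(Real.log (2 * K / δ) / (2 * B))} ≤ δ / K := by
  refine (measureReal_not_cvar_le_le hB hlaw hindep hX hb hα0 hα1 (Real.sqrt_nonneg _)).trans_eq ?_
  have h1 : 1 ≤ 2 * K / δ := by rw [le_div_iff₀ hδ0]; linarith
  have hB' : (B : ℝ) ≠ 0 := by positivity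
  rw [Real.sq_sqrt (div_nonneg (Real.log_nonneg h1) (by positivity)),
    mul_div_cancel₀ _ (by positivity), Real.exp_neg, Real.exp_log (by positivity)]
  field_simp

lemma one_sub_le_measureReal {p : Ω → Prop} {δ : ℝ} (h : P.real {ω | ¬ p ω} ≤ δ) :
    1 - δ ≤ P.real {ω | p ω} := by
  -- subadditivity of the outer measure, so that `p` need not be measurable
  have h1 : P.real ({ω | p ω} ∪ {ω | ¬ p ω}) ≤ P.real {ω | p ω} + P.real {ω | ¬ p ω} :=
    measureReal_union_le _ _
  have h2 : {ω | p ω} ∪ {ω | ¬ p ω} = univ := union_compl_self _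
  rw [h2, probReal_univ] at h1
  linarith

end Concentration

/-! ### Projected gradient ascent on the multipliers -/

section DualUpdate

variable {m : ℕ}

lemma hasGradientAt_lagrangianConstraint (g v : EuclideanSpace ℝ (Fin m)) :
    HasGradientAt (lagrangianConstraint g) g v := by
  have h : lagrangianConstraint g = fun lam => InnerProductSpace.toDual ℝ _ g lam := by
    ext lam
    simp [lagrangianConstraint, PiLp.inner_apply]
  rw [hasGradientAt_iff_hasFDerivAt, h]
  exact ContinuousLinearMap.hasFDerivAt _

lemma isMetricProj_nonnegOrthant {v p : EuclideanSpace ℝ (Fin m)} (h : ∀ j, p j = max (v j) 0) :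
    IsMetricProj (nonnegOrthant m) v p := by
  refine ⟨fun j => by rw [h]; exact le_max_right _ _, fun y hy => ?_⟩
  rw [EuclideanSpace.dist_eq, EuclideanSpace.dist_eq]
  refine Real.sqrt_le_sqrt (Finset.sum_le_sum fun j _ => ?_)
  have hyj : 0 ≤ y j := hy j
  rw [Real.dist_eq, Real.dist_eq, sq_abs, sq_abs, h]
  rcases max_cases (v j) 0 with ⟨h1, h2⟩ | ⟨h1, h2⟩ <;> rw [h1] <;> nlinarith

lemma lagrangianConstraint_add_le {g v w : EuclideanSpace ℝ (Fin m)} {s : ℝ} (hs : 0 < s)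
    (hv : ∀ j, 0 ≤ v j) (hw : ∀ j, w j = max (v j + s * g j) 0) :
    lagrangianConstraint g v + ‖w - v‖ ^ 2 / s ≤ lagrangianConstraint g w := by
  rw [EuclideanSpace.norm_sq_eq, Finset.sum_div]
  unfold lagrangianConstraint
  rw [← Finset.sum_add_distrib]
  refine Finset.sum_le_sum fun j _ => ?_
  rw [PiLp.sub_apply, Real.norm_eq_abs, sq_abs, ← le_sub_iff_add_le', ← sub_mul, div_le_iff₀ hs]
  have hvj := hv j
  rw [hw]
  rcases max_cases (v j + s * g j) 0 with ⟨h1, h2⟩ | ⟨h1, h2⟩ <;> rw [h1] <;> nlinarith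

lemma lt_max_add_mul_iff {a s g : ℝ} (ha : 0 ≤ a) (hs : 0 < s) :
    a < max (a + s * g) 0 ↔ 0 < g := by
  rw [lt_max_iff, or_iff_left ha.not_gt, lt_add_iff_pos_right, mul_pos_iff_of_pos_left hs]

end DualUpdate

theorem mainTheorem3
    {Θ T Ξ Ω : Type*} [MeasurableSpace Ξ] [MeasurableSpace Ω]
    -- number of risk channels, number of validation rollouts
    (m B : ℕ) (hB : 0 < B)
    -- `rollout θ x` is the trajectory of the policy `θ` under the rollout randomness `x`,
    -- and `C j` is the exposure of a trajectory in channel `j`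
    (rollout : Θ → Ξ → T) (C : Fin m → T → ℝ)
    (α Cmax rhoBar : Fin m → ℝ) (hα : ∀ j, 0 < α j ∧ α j < 1)
    (δ : ℝ) (hδ0 : 0 < δ) (hδ1 : δ < 1)
    -- law of the rollout randomness, and i.i.d. draws from it
    (ν : Measure Ξ) [IsProbabilityMeasure ν]
    (P : Measure Ω) [IsProbabilityMeasure P]
    (ξ : Fin B → Ω → Ξ) (hlaw : ∀ i, HasLaw (ξ i) ν P) (hindep : iIndepFun ξ P)
    -- a policy that is fixed before the draws, with bounded exposures
    (θhat : Θ) (hmeas : ∀ j, Measurable fun x => C j (rollout θhat x))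
    (hbdd : ∀ j, ∀ᵐ x ∂ν, C j (rollout θhat x) ∈ Set.Icc 0 (Cmax j)) :
    -- upper-confidence bound for a single channel
    (∀ j, 1 - δ ≤ P.real {ω |
      cvar ν (α j) (fun x => C j (rollout θhat x)) ≤
        empCvar (α j) (fun i => C j (rollout θhat (ξ i ω))) +
          Cmax j / (1 - α j) * √(Real.log (2 / δ) / (2 * B))}) ∧
    -- simultaneous upper-confidence bound for all channels
    (1 - δ ≤ P.real {ω | ∀ j,
      cvar ν (α j) (fun x => C j (rollout θhat x)) ≤
        empCvar (α j) (fun i => C j (rollout θhat (ξ i ω))) +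
          Cmax j / (1 - α j) * √(Real.log (2 * m / δ) / (2 * B))}) ∧
    -- feasibility of the estimates implies true feasibility, with probability at least `1 - δ`
    (1 - δ ≤ P.real {ω |
      (∀ j, ucbCvar (α j) (Cmax j) m δ (fun i => C j (rollout θhat (ξ i ω))) ≤ rhoBar j) →
        ∀ j, cvar ν (α j) (fun x => C j (rollout θhat x)) ≤ rhoBar j}) ∧
    -- the projected dual update along arbitrary policies `θ k`, with the upper-confidence
    -- estimates at step `k` computed from arbitrary realised randomness `x k`
    (∀ (θ : ℕ → Θ) (x : ℕ → Fin B → Ξ) (step : ℝ) (_ : 0 < step)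
      (rhoHat : ℕ → Fin m → ℝ)
      (_ : ∀ k j, rhoHat k j =
        ucbCvar (α j) (Cmax j) m δ (fun i => C j (rollout (θ k) (x k i))))
      (lam : ℕ → EuclideanSpace ℝ (Fin m)) (_ : ∀ j, 0 ≤ lam 0 j)
      (_ : ∀ k j, lam (k + 1) j = max (lam k j + step * (rhoHat k j - rhoBar j)) 0)
      (g : ℕ → EuclideanSpace ℝ (Fin m)) (_ : ∀ k j, g k j = rhoHat k j - rhoBar j) (k : ℕ),
      -- it is a projected gradient ascent step
      HasGradientAt (lagrangianConstraint (g k)) (g k) (lam k) ∧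
      IsMetricProj (nonnegOrthant m) (lam k + step • g k) (lam (k + 1)) ∧
      -- it increases the constraint part of the Lagrangian
      lagrangianConstraint (g k) (lam k) + ‖lam (k + 1) - lam k‖ ^ 2 / step ≤
        lagrangianConstraint (g k) (lam (k + 1)) ∧
      -- a price increases exactly when its upper-confidence budget is violated
      ∀ j, lam k j < lam (k + 1) j ↔ rhoBar j < rhoHat k j) := by
  have hone : ∀ K : ℝ, 1 ≤ K → ∀ j, P.real {ω |
      ¬ cvar ν (α j) (fun x => C j (rollout θhat x)) ≤
        empCvar (α j) (fun i => C j (rollout θhat (ξ i ω))) +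
          Cmax j / (1 - α j) * √(Real.log (2 * K / δ) / (2 * B))} ≤ δ / K := fun K hK j =>
    measureReal_not_cvar_le_le_div hB hlaw hindep (hmeas j) (hbdd j) (hα j).1 (hα j).2 hδ0 hδ1 hK
  have hall : P.real {ω | ¬ ∀ j, cvar ν (α j) (fun x => C j (rollout θhat x)) ≤
        empCvar (α j) (fun i => C j (rollout θhat (ξ i ω))) +
          Cmax j / (1 - α j) * √(Real.log (2 * m / δ) / (2 * B))} ≤ δ := by
    simp only [not_forall, ofPred_exists]
    refine (measureReal_iUnion_fintype_le _).trans ?_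
    rcases Nat.eq_zero_or_pos m with rfl | hm
    · simpa using hδ0.le
    · refine (Finset.sum_le_sum fun j _ => hone m (by exact_mod_cast hm) j).trans_eq ?_
      have : (m : ℝ) ≠ 0 := by positivity
      simp [mul_div_cancel₀ _ this]
  refine ⟨fun j => one_sub_le_measureReal ?_, one_sub_le_measureReal hall,
    (one_sub_le_measureReal hall).trans (measureReal_mono fun ω hω hfeas j =>
      (hω j).trans (hfeas j)), ?_⟩
  · simpa using hone 1 le_rfl j
  · intro θ x step hstep rhoHat _ lam h0 hlam g hg k
    have hnn : ∀ j, 0 ≤ lam k j := by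
      cases k with
      | zero => exact h0
      | succ k => intro j; rw [hlam]; exact le_max_right _ _
    have hupd : ∀ j, lam (k + 1) j = max (lam k j + step * g k j) 0 := fun j => by
      rw [hlam, hg]
    refine ⟨hasGradientAt_lagrangianConstraint _ _,
      isMetricProj_nonnegOrthant fun j => by simp [hupd],
      lagrangianConstraint_add_le hstep hnn hupd, fun j => ?_⟩
    rw [hupd, lt_max_add_mul_iff (hnn j) hstep, hg, sub_pos]
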